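/- Let $A$ be a totally ordered set, and let $\mathbf{Pl}_A$ be the plactic monoid on $A$, i.e. the quotient of the free monoid $A^*$ by the congruence generated by the Knuth relations $$xzy \sim zxy \quad (x \le y < z), \qquad yxz \sim yzx \quad (x < y \le z), \qquad x,y,z \in A.$$ If $A = \{a_1 < a_2 < \cdots < a_n\}$ is finite with $n \ge 1$, then the center of $\mathbf{Pl}_A$ is the free monoid generated by the single element $c_A$, the class of the longest column $a_n a_{n-1} \cdots a_2 a_1$; that is, the powers $c_A^k$ ($k \ge 0$) are pairwise distinct and are exactly the central elements of $\mathbf{Pl}_A$. If $A$ is infinite, then the center of $\mathbf{Pl}_A$ is trivial, i.e. equal to $\{1\}$. -/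

import Mathlib

/-- The defining (Knuth) relations of the plactic monoid on a totally ordered alphabet `A`:
`xzy ∼ zxy` for `x ≤ y < z`, and `yxz ∼ yzx` for `x < y ≤ z`. -/
inductive KnuthRel (A : Type*) [LinearOrder A] : FreeMonoid A → FreeMonoid A → Prop
  | swap_left (x y z : A) (hxy : x ≤ y) (hyz : y < z) :
      KnuthRel A (FreeMonoid.ofList [x, z, y]) (FreeMonoid.ofList [z, x, y])
  | swap_right (x y z : A) (hxy : x < y) (hyz : y ≤ z) :
      KnuthRel A (FreeMonoid.ofList [y, x, z]) (FreeMonoid.ofList [y, z, x])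

/-- The plactic monoid: the quotient of the free monoid on `A` by the congruence generated by the
Knuth relations. -/
abbrev PlacticMonoid (A : Type*) [LinearOrder A] : Type _ :=
  PresentedMonoid (KnuthRel A)

/-- The class in the plactic monoid of the longest column `aₙ ⋯ a₂ a₁`, the word listing each
letter of the finite alphabet `A = {a₁ < a₂ < ⋯ < aₙ}` once, in decreasing order. -/
def longestColumn (A : Type*) [LinearOrder A] [Fintype A] : PlacticMonoid A :=
  PresentedMonoid.mk (KnuthRel A)
    (FreeMonoid.ofList ((Finset.univ : Finset A).sort (· ≥ ·)))

/-- The submonoid `N` of `M` is the free monoid on the subset `S` of `M`: the canonical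
homomorphism from the free monoid on `S` to `M` is injective with image `N`. -/
def IsFreeMonoidOn {M : Type*} [Monoid M] (N : Submonoid M) (S : Set M) : Prop :=
  Function.Injective (FreeMonoid.lift ((↑) : S → M)) ∧
    MonoidHom.mrange (FreeMonoid.lift ((↑) : S → M)) = N

/-! A column commutes with each of its own letters. Hence the longest column is central, and the
columns of letters `≥ a` (top columns), being nested, commute with one another.

Conversely, for `a < b` let `a` act on `ℕ` as successor, `b` as truncated predecessor, letters
strictly between as zero and all others as the identity. This respects the Knuth relations
(`pairAct`). If a central word has no letter strictly between `a` and `b`, its image commutes with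
successor and predecessor, so it is the identity (`wordAct_eq_one`). Hence `a` and `b` occur equally
often, and no prefix has more `a` than `b`.

For infinite `A`, comparing an absent letter with the nearest letter that occurs shows that a
central word is empty. For finite `A`, covering pairs give the ballot condition on prefixes, which
makes the word a product of top columns (`word_eq_prod_topColumn`); equal counts force every factor
to be the longest column. -/

namespace PlacticMonoid

variable {A : Type*} [LinearOrder A]

/-- The class of a word in the plactic monoid. -/
def word (l : List A) : PlacticMonoid A :=
  PresentedMonoid.mk (KnuthRel A) (FreeMonoid.ofList l)

@[simp] theorem word_nil : word ([] : List A) = 1 := map_one _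

theorem word_append (l m : List A) : word (l ++ m) = word l * word m := by
  simp [word, FreeMonoid.ofList_append]

theorem word_cons (a : A) (l : List A) : word (a :: l) = word [a] * word l :=
  word_append [a] l

theorem exists_word_eq (g : PlacticMonoid A) : ∃ l, word l = g := by
  obtain ⟨l, rfl⟩ := PresentedMonoid.surjective_mk g
  exact ⟨l.toList, rfl⟩

theorem word_swap_left {x y z : A} (hxy : x ≤ y) (hyz : y < z) :
    word [x, z, y] = word [z, x, y] :=
  PresentedMonoid.mk_eq_mk_of_rel (.swap_left x y z hxy hyz)

theorem word_swap_right {x y z : A} (hxy : x < y) (hyz : y ≤ z) :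
    word [y, x, z] = word [y, z, x] :=
  PresentedMonoid.mk_eq_mk_of_rel (.swap_right x y z hxy hyz)

/-! ### Columns and their commutation -/

/-- A large letter moves leftwards through a column, up to its first letter. -/
theorem word_column_append (a : A) (v : List A) (y : A) (hy : y ≤ a)
    (hv : (y :: v).Pairwise (· > ·)) : word (y :: (v ++ [a])) = word (y :: a :: v) := by
  induction v generalizing y with
  | nil => rfl
  | cons x v ih =>
    have hxy : x < y := List.rel_of_pairwise_cons hv List.mem_cons_self
    rw [word_cons, List.cons_append, ih x (hxy.le.trans hy) hv.of_cons, ← word_cons]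
    change word ([y, x, a] ++ v) = word ([y, a, x] ++ v)
    rw [word_append, word_swap_right hxy hy, ← word_append]

/-- A small letter moves rightwards through a column, up to its last letter. -/
theorem word_cons_column (a : A) (u : List A) (y : A) (hy : a ≤ y)
    (hu : (u ++ [y]).Pairwise (· > ·)) : word (a :: (u ++ [y])) = word (u ++ [a, y]) := by
  induction u with
  | nil => rfl
  | cons z u ih =>
    have ih := ih hu.of_cons
    obtain ⟨t, r, htr⟩ : ∃ t r, u ++ [y] = t :: r := by
      cases u <;> simp
    have hzt : t < z := List.rel_of_pairwise_cons hu (by simp [htr])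
    have hat : a ≤ t := by
      have ht : t ∈ u ++ [y] := by simp [htr]
      rcases List.mem_append.1 ht with h | h
      · exact hy.trans (List.pairwise_append.1 hu.of_cons |>.2.2 t h y (by simp)).le
      · simp_all
    rw [List.cons_append, List.cons_append, word_cons z (u ++ [a, y]), ← ih, htr, ← word_cons]
    change word ([a, z, t] ++ r) = word ([z, a, t] ++ r)
    rw [word_append, word_swap_left hat hzt, ← word_append]

/-- A column commutes with each of its letters. -/
theorem commute_word_of_mem {l : List A} (hl : l.Pairwise (· > ·)) {a : A} (ha : a ∈ l) :
    Commute (word l) (word [a]) := by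
  obtain ⟨u, v, rfl⟩ := List.append_of_mem ha
  have hv := (List.pairwise_append.1 hl).2.1
  have hu : (u ++ [a]).Pairwise (· > ·) := by
    refine hl.sublist ?_
    simp
  calc word (u ++ a :: v) * word [a] = word u * word (a :: (v ++ [a])) := by
        rw [← word_append, ← word_append]; simp
    _ = word (u ++ [a, a]) * word v := by
        rw [word_column_append a v a le_rfl hv, ← word_append, ← word_append]; simp
    _ = word [a] * word (u ++ a :: v) := by
        rw [← word_cons_column a u a le_rfl hu, ← word_append, ← word_append]; simp

/-- The column with set of letters `s`. -/
def column (s : Finset A) : PlacticMonoid A := word (s.sort (· ≥ ·))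

theorem commute_column_of_mem {s : Finset A} {a : A} (ha : a ∈ s) :
    Commute (column s) (word [a]) :=
  commute_word_of_mem (s.sortedGT_sort).pairwise ((s.mem_sort _).2 ha)

theorem commute_column_word {s : Finset A} {l : List A} (hl : ∀ a ∈ l, a ∈ s) :
    Commute (column s) (word l) := by
  induction l with
  | nil => simp
  | cons a l ih =>
    rw [word_cons]
    exact (commute_column_of_mem (hl a (by simp))).mul_right
      (ih fun b hb => hl b (List.mem_cons_of_mem a hb))

theorem commute_column_of_subset {s t : Finset A} (h : t ⊆ s) :
    Commute (column s) (column t) :=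
  commute_column_word fun _ ha => h ((t.mem_sort _).1 ha)

theorem column_insert {s : Finset A} {b : A} (h : ∀ x ∈ s, b < x) :
    column (insert b s) = column s * word [b] := by
  rw [column, column, ← word_append]
  congr 1
  have hb : b ∉ s := fun hb => (h b hb).false
  refine List.Perm.eq_of_pairwise (le := (· > ·)) (fun x y _ _ hxy hyx => (hxy.asymm hyx).elim)
    (Finset.sortedGT_sort _).pairwise ?_ ?_
  · rw [List.pairwise_append]
    exact ⟨(Finset.sortedGT_sort _).pairwise, by simp, by simpa using h⟩
  · rw [List.perm_ext_iff_of_nodup (Finset.sort_nodup _ _)]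
    · simp [or_comm]
    · rw [List.nodup_append]
      refine ⟨Finset.sort_nodup _ _, by simp, ?_⟩
      simp only [Finset.mem_sort, List.mem_singleton]
      rintro x hx _ rfl rfl
      exact hb hx

/-! ### Counting letters -/

/-- The number of letters of a plactic class. -/
def length : PlacticMonoid A →* Multiplicative ℕ :=
  PresentedMonoid.lift (fun _ => Multiplicative.ofAdd 1) (by
    rintro _ _ (⟨x, y, z, -, -⟩ | ⟨x, y, z, -, -⟩) <;> simp)

theorem length_word (l : List A) : length (word l) = Multiplicative.ofAdd l.length := by
  change FreeMonoid.lift _ (FreeMonoid.ofList l) = _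
  rw [FreeMonoid.lift_ofList]
  induction l with
  | nil => rfl
  | cons a l ih =>
    rw [List.map_cons, List.prod_cons, ih, List.length_cons, add_comm l.length, ofAdd_add]

/-! ### The bicyclic representation attached to a pair of letters -/

/-- The successor as an element of the monoid of self-maps of `ℕ`. -/
def endSucc : Function.End ℕ := Nat.succ

/-- The truncated predecessor as an element of the monoid of self-maps of `ℕ`. -/
def endPred : Function.End ℕ := Nat.pred

theorem endPred_mul_endSucc : endPred * endSucc = 1 := rfl

/-- The action of a letter on `ℕ`: `a` acts as successor, `b` as predecessor. -/
def letterAct (a b x : A) : Function.End ℕ :=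
  if x = a then endSucc else if x = b then endPred else 1

/-- The action of a word on `ℕ`. -/
def wordAct (a b : A) (l : List A) : Function.End ℕ := (l.map (letterAct a b)).prod

/-- The action of a letter, where letters strictly between `a` and `b` act as zero. -/
def letterActZero (a b x : A) : WithZero (Function.End ℕ) :=
  if a < x ∧ x < b then 0 else (letterAct a b x : WithZero (Function.End ℕ))

theorem letterAct_apply (a b x : A) (n : ℕ) :
    letterAct a b x n = if x = a then n + 1 else if x = b then n - 1 else n := by
  rw [letterAct]
  split_ifs <;> rfl

theorem wordAct_apply_cons (a b x : A) (l : List A) (n : ℕ) :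
    wordAct a b (x :: l) n = letterAct a b x (wordAct a b l n) := rfl

theorem letterActZero_left {a b : A} : letterActZero a b a =
    (endSucc : WithZero (Function.End ℕ)) := by
  simp [letterActZero, letterAct]

theorem letterActZero_right {a b : A} (hab : a < b) : letterActZero a b b =
    (endPred : WithZero (Function.End ℕ)) := by
  simp [letterActZero, letterAct, hab.ne']

theorem letterActZero_between {a b x : A} (h : a < x) (h' : x < b) : letterActZero a b x = 0 := by
  simp [letterActZero, h, h']

theorem letterActZero_outside {a b x : A} (h : x < a ∨ b < x) (hab : a < b) :
    letterActZero a b x = 1 := by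
  have : ¬ (a < x ∧ x < b) := by grind
  have h1 : x ≠ a := by grind
  have h2 : x ≠ b := by grind
  simp [letterActZero, letterAct, h1, h2, this]

theorem right_mul_left {a b : A} (hab : a < b) :
    letterActZero a b b * letterActZero a b a = 1 := by
  rw [letterActZero_left, letterActZero_right hab, ← WithZero.coe_mul,
    endPred_mul_endSucc, WithZero.coe_one]

/-- Letters outside `[a, b]` act trivially, and a letter strictly between kills both sides. What
remains is `x = y = a`, `z = b`, where both sides reduce to successor because `b * a` acts as the
identity. -/
theorem letterActZero_swap_left {a b : A} (hab : a < b) {x y z : A} (hxy : x ≤ y) (hyz : y < z) :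
    letterActZero a b x * (letterActZero a b z * letterActZero a b y) =
      letterActZero a b z * (letterActZero a b x * letterActZero a b y) := by
  by_cases hx : x < a
  · simp [letterActZero_outside (.inl hx) hab]
  by_cases hz : b < z
  · simp [letterActZero_outside (.inr hz) hab]
  rcases (not_lt.1 hx).eq_or_lt with rfl | hx
  · rcases hxy.eq_or_lt with rfl | hxy
    · rcases (not_lt.1 hz).eq_or_lt with rfl | hz
      · rw [right_mul_left hab, ← mul_assoc, right_mul_left hab, one_mul, mul_one]
      · simp [letterActZero_between hyz hz]
    · simp [letterActZero_between hxy (hyz.trans_le (not_lt.1 hz))]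
  · simp [letterActZero_between hx (hxy.trans_lt (hyz.trans_le (not_lt.1 hz)))]

/-- The same reduction leaves only `x = a`, `y = z = b`, where both sides reduce to predecessor. -/
theorem letterActZero_swap_right {a b : A} (hab : a < b) {x y z : A} (hxy : x < y) (hyz : y ≤ z) :
    letterActZero a b y * (letterActZero a b x * letterActZero a b z) =
      letterActZero a b y * (letterActZero a b z * letterActZero a b x) := by
  by_cases hx : x < a
  · simp [letterActZero_outside (.inl hx) hab]
  by_cases hz : b < z
  · simp [letterActZero_outside (.inr hz) hab]
  have hay : a < y := (not_lt.1 hx).trans_lt hxy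
  rcases (hyz.trans (not_lt.1 hz)).eq_or_lt with rfl | hyb
  · obtain rfl : z = y := le_antisymm (not_lt.1 hz) hyz
    rcases (not_lt.1 hx).eq_or_lt with rfl | hx
    · rw [right_mul_left hab, ← mul_assoc, right_mul_left hab, one_mul, mul_one]
    · simp [letterActZero_between hx hxy]
  · simp [letterActZero_between hay hyb]

/-- The representation of the plactic monoid in the bicyclic monoid with a zero adjoined. -/
def pairAct {a b : A} (hab : a < b) : PlacticMonoid A →* WithZero (Function.End ℕ) :=
  PresentedMonoid.lift (letterActZero a b) (by
    rintro _ _ (⟨x, y, z, hxy, hyz⟩ | ⟨x, y, z, hxy, hyz⟩)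
    · simpa [FreeMonoid.lift_ofList] using letterActZero_swap_left hab hxy hyz
    · simpa [FreeMonoid.lift_ofList] using letterActZero_swap_right hab hxy hyz)

theorem pairAct_word {a b : A} (hab : a < b) {l : List A} (hl : ∀ x ∈ l, ¬ (a < x ∧ x < b)) :
    pairAct hab (word l) = (wordAct a b l : WithZero (Function.End ℕ)) := by
  change FreeMonoid.lift _ (FreeMonoid.ofList l) = _
  rw [FreeMonoid.lift_ofList]
  induction l with
  | nil => rfl
  | cons x l ih =>
    rw [List.map_cons, List.prod_cons, ih fun y hy => hl y (List.mem_cons_of_mem x hy),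
      letterActZero, if_neg (hl x List.mem_cons_self), ← WithZero.coe_mul]
    rfl

theorem eq_one_of_commute {f : Function.End ℕ} (h : Commute f endSucc) (h' : Commute f endPred) :
    f = 1 := by
  have hs : ∀ n, f (n + 1) = f n + 1 := fun n => congrFun h n
  -- Truncation matters here: only `0` is a fixed point of `Nat.pred`.
  have h0 : f 0 = Nat.pred (f 0) := congrFun h' 0
  have h0 : f 0 = 0 := by rw [Nat.pred_eq_sub_one] at h0; omega
  funext n
  change f n = n
  induction n with
  | zero => exact h0
  | succ n ih => rw [hs, ih]

theorem wordAct_eq_one {a b : A} (hab : a < b) {l : List A} (hl : ∀ x ∈ l, ¬ (a < x ∧ x < b))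
    (h : word l ∈ Submonoid.center (PlacticMonoid A)) : wordAct a b l = 1 := by
  rw [Submonoid.mem_center_iff] at h
  have key (x : A) (hx : ¬ (a < x ∧ x < b)) : Commute (wordAct a b l) (letterAct a b x) := by
    have := congrArg (pairAct hab) (h (word [x]))
    rw [map_mul, map_mul, pairAct_word hab hl, pairAct_word hab (by simpa using hx),
      ← WithZero.coe_mul, ← WithZero.coe_mul, WithZero.coe_inj] at this
    have h1 : wordAct a b [x] = letterAct a b x := by simp [wordAct]
    rw [h1] at this
    exact this.symm
  refine eq_one_of_commute ?_ ?_
  · simpa [letterAct] using key a (by simp)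
  · simpa [letterAct, hab.ne'] using key b (by simp)

/-- Without truncation the action would be translation by `count a - count b`; truncation can only
increase the result. -/
theorem le_wordAct (a b : A) (l : List A) (n : ℕ) :
    n + l.count a ≤ wordAct a b l n + l.count b := by
  induction l with
  | nil => exact le_rfl
  | cons x l ih =>
    rw [wordAct_apply_cons, List.count_cons, List.count_cons]
    have := letterAct_apply a b x (wordAct a b l n)
    grind

/-- Starting from at least `count b`, no predecessor is ever applied to `0`, so the action is an
honest translation. -/
theorem wordAct_le {a b : A} (hab : a < b) (l : List A) (n : ℕ) (hn : l.count b ≤ n) :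
    wordAct a b l n + l.count b ≤ n + l.count a := by
  induction l with
  | nil => exact le_rfl
  | cons x l ih =>
    rw [wordAct_apply_cons, List.count_cons, List.count_cons]
    rw [List.count_cons] at hn
    have := letterAct_apply a b x (wordAct a b l n)
    grind

theorem count_eq_of_mem_center {a b : A} (hab : a < b) {l : List A}
    (hl : ∀ x ∈ l, ¬ (a < x ∧ x < b)) (h : word l ∈ Submonoid.center (PlacticMonoid A)) :
    l.count a = l.count b := by
  have h1 := le_wordAct a b l (l.count b)
  have h2 := wordAct_le hab l (l.count b) le_rfl
  have h3 : wordAct a b l (l.count b) = l.count b := congrFun (wordAct_eq_one hab hl h) _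
  omega

theorem count_prefix_le_of_mem_center {a b : A} (hab : a < b) {l m : List A}
    (hl : ∀ x ∈ l ++ m, ¬ (a < x ∧ x < b))
    (h : word (l ++ m) ∈ Submonoid.center (PlacticMonoid A)) : l.count a ≤ l.count b := by
  -- The last letter acts first: the suffix `m` moves `0` to some value, which the prefix `l` must
  -- bring back down to `0`.
  have h1 := le_wordAct a b l (wordAct a b m 0)
  have h2 : wordAct a b (l ++ m) = wordAct a b l * wordAct a b m := by simp [wordAct]
  have h3 : wordAct a b l (wordAct a b m 0) = 0 :=
    congrFun (h2.symm.trans (wordAct_eq_one hab hl h)) 0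
  omega

/-! ### The infinite case -/

/-- The letter of `l` closest to an absent letter `d`, on either side, has no letter of `l` strictly
between it and `d`, so it would have to occur as often as `d`, that is, never. -/
theorem center_eq_bot [Infinite A] : Submonoid.center (PlacticMonoid A) = ⊥ := by
  rw [Submonoid.eq_bot_iff_forall]
  intro g hg
  obtain ⟨l, rfl⟩ := exists_word_eq g
  by_contra hne
  obtain ⟨d, hd⟩ := Infinite.exists_notMem_finset l.toFinset
  rw [List.mem_toFinset] at hd
  have hd0 : l.count d = 0 := List.count_eq_zero.2 hd
  obtain ⟨x, hx⟩ : ∃ x, x ∈ l := List.exists_mem_of_ne_nil l (by rintro rfl; exact hne word_nil)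
  rcases lt_or_gt_of_ne (show x ≠ d by rintro rfl; exact hd hx) with hxd | hxd
  · obtain ⟨y, hy, hmax⟩ := (l.toFinset.filter (· < d)).exists_maximal ⟨x, by simp [hx, hxd]⟩
    simp only [Finset.mem_filter, List.mem_toFinset] at hy hmax
    have := count_eq_of_mem_center hy.2 (l := l)
      (fun z hz h => (hmax ⟨hz, h.2⟩ h.1.le).not_gt h.1) hg
    exact List.count_eq_zero.1 (this.trans hd0) hy.1
  · obtain ⟨y, hy, hmin⟩ := (l.toFinset.filter (d < ·)).exists_minimal ⟨x, by simp [hx, hxd]⟩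
    simp only [Finset.mem_filter, List.mem_toFinset] at hy hmin
    have := count_eq_of_mem_center hy.2 (l := l)
      (fun z hz h => (hmin ⟨hz, h.1⟩ h.2.le).not_gt h.2) hg
    exact List.count_eq_zero.1 (this.symm.trans hd0) hy.1

/-! ### The finite case -/

section Finite

variable [Fintype A]

/-- The column of all letters that are at least `a`. -/
def topColumn (a : A) : PlacticMonoid A := column (Finset.univ.filter (a ≤ ·))

theorem commute_topColumn (a b : A) : Commute (topColumn a) (topColumn b) := by
  wlog h : a ≤ b generalizing a b
  · exact (this b a (le_of_not_ge h)).symm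
  · refine commute_column_of_subset fun x hx => ?_
    simp only [Finset.mem_filter, Finset.mem_univ, true_and] at hx ⊢
    exact h.trans hx

theorem topColumn_of_isMax {b : A} (hb : IsMax b) : topColumn b = word [b] := by
  have : Finset.univ.filter (b ≤ ·) = insert b (∅ : Finset A) := by
    ext x
    simpa using ⟨fun h => le_antisymm (hb h) h, fun h => h.ge⟩
  rw [topColumn, this, column_insert (by simp)]
  simp [column]

theorem topColumn_of_covBy {b c : A} (h : b ⋖ c) : topColumn b = topColumn c * word [b] := by
  have : Finset.univ.filter (b ≤ ·) = insert b (Finset.univ.filter (c ≤ ·)) := by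
    ext x
    simp only [Finset.mem_filter, Finset.mem_univ, true_and, Finset.mem_insert]
    rw [le_iff_eq_or_lt, h.lt_iff_le_right, eq_comm]
  rw [topColumn, this, column_insert]
  · rfl
  · intro x hx
    exact h.lt.trans_le (by simpa using hx)

/-- A word whose prefixes contain each letter at most as often as the next larger one is
plactic-equivalent to a product of top columns. -/
theorem word_eq_prod_topColumn (l : List A)
    (hl : ∀ p s : List A, p ++ s = l → ∀ a b : A, a ⋖ b → p.count a ≤ p.count b) :
    ∃ ks : List A, word l = (ks.map topColumn).prod ∧
      ∀ a, l.count a = ks.countP (· ≤ a) := by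
  induction l using List.reverseRecOn with
  | nil => exact ⟨[], by simp⟩
  | append_singleton l b ih =>
    obtain ⟨ks, hks, hcount⟩ := ih fun p s h => hl p (s ++ [b]) (by simp [← h])
    by_cases hb : IsMax b
    · refine ⟨ks ++ [b], by simp [word_append, hks, topColumn_of_isMax hb], fun a => ?_⟩
      have : b = a ↔ b ≤ a := ⟨fun h => h.le, fun h => le_antisymm h (hb h)⟩
      simp [List.count_append, hcount, List.countP_append, List.countP_cons, List.count_cons, this]
    · obtain ⟨c, hbc⟩ := exists_covBy_of_wellFoundedLT hb
      -- By the count invariant, the ballot condition after appending `b` says that strictly more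
      -- columns start at a letter `≤ c` than at one `≤ b`, so some column starts exactly at `c`.
      -- Since top columns commute, it can be moved to the end, where it absorbs `b`.
      have hlt : ks.countP (· ≤ b) < ks.countP (· ≤ c) := by
        have := hl (l ++ [b]) [] (by simp) b c hbc
        simp only [List.count_append, hcount] at this
        simpa [List.count_cons, hbc.ne, Nat.succ_le_iff] using this
      have hc : c ∈ ks := by
        by_contra hc
        refine hlt.not_ge (List.countP_mono_left fun x hx hxc => ?_)
        simp only [decide_eq_true_eq] at hxc ⊢
        exact hbc.le_of_lt (lt_of_le_of_ne hxc (by rintro rfl; exact hc hx))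
      have hperm := List.perm_cons_erase hc
      have hperm' : List.Perm ks (ks.erase c ++ [c]) :=
        hperm.trans (List.perm_append_singleton _ _).symm
      refine ⟨ks.erase c ++ [b], ?_, fun a => ?_⟩
      · have hprod : (ks.map topColumn).prod = ((ks.erase c ++ [c]).map topColumn).prod :=
          (hperm'.map _).prod_eq' (List.pairwise_map.2
            (List.pairwise_of_forall commute_topColumn))
        rw [word_append, hks, hprod]
        simp [mul_assoc, topColumn_of_covBy hbc]
      · have h1 := hperm'.countP_eq (· ≤ a)
        simp only [List.countP_append, List.countP_singleton, decide_eq_true_eq] at h1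
        simp only [List.count_append, List.countP_append, hcount, h1, List.count_singleton,
          List.countP_singleton, decide_eq_true_eq, beq_iff_eq]
        have h2 : c ≤ a ↔ b < a := hbc.lt_iff_le_right.symm
        have h3 : b ≤ a ↔ b = a ∨ b < a := le_iff_eq_or_lt
        have h4 : b = a → ¬ b < a := fun h => h.not_lt
        by_cases b = a <;> by_cases b < a <;> simp_all
        all_goals grind

theorem longestColumn_eq_column : longestColumn A = column Finset.univ := rfl

theorem longestColumn_mem_center : longestColumn A ∈ Submonoid.center (PlacticMonoid A) := by
  rw [Submonoid.mem_center_iff]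
  intro g
  obtain ⟨l, rfl⟩ := exists_word_eq g
  exact (commute_column_word fun a _ => Finset.mem_univ a).symm

theorem count_eq_count_of_mem_center {l : List A}
    (h : word l ∈ Submonoid.center (PlacticMonoid A)) (a b : A) : l.count a = l.count b := by
  wlog hab : a ≤ b generalizing a b
  · exact (this b a (le_of_not_ge hab)).symm
  induction b using WellFoundedLT.induction with
  | ind b ih =>
    rcases hab.eq_or_lt with rfl | hab
    · rfl
    · obtain ⟨c, hac, hcb⟩ := exists_le_covBy_of_lt hab
      exact (ih c hcb.lt hac).trans (count_eq_of_mem_center hcb.lt (fun x _ hx => hcb.2 hx.1 hx.2) h)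

theorem exists_longestColumn_pow_eq [Nonempty A] {g : PlacticMonoid A}
    (hg : g ∈ Submonoid.center (PlacticMonoid A)) : ∃ k : ℕ, longestColumn A ^ k = g := by
  obtain ⟨l, rfl⟩ := exists_word_eq g
  obtain ⟨ks, hks, hcount⟩ := word_eq_prod_topColumn l fun p s hps a b hab => by
    subst hps
    exact count_prefix_le_of_mem_center hab.lt (fun x _ hx => hab.2 hx.1 hx.2) hg
  obtain ⟨bot, hbot⟩ := Finite.exists_min (id : A → A)
  obtain ⟨top, htop⟩ := Finite.exists_max (id : A → A)
  simp only [id_eq] at hbot htop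
  -- The largest letter lies in every top column, the smallest only in the full one; equal counts
  -- make all the columns full.
  have htop' : ks.countP (· ≤ top) = ks.length :=
    List.countP_eq_length.2 (by simpa using fun x _ => htop x)
  have hbot' : ks.countP (· ≤ bot) = ks.length := by
    rw [← hcount, count_eq_count_of_mem_center hg bot top, hcount, htop']
  rw [List.countP_eq_length] at hbot'
  have hrep : ks = List.replicate ks.length bot :=
    List.eq_replicate_iff.2 ⟨rfl, fun x hx => le_antisymm (by simpa using hbot' x hx) (hbot x)⟩
  refine ⟨ks.length, ?_⟩
  have hcol : topColumn bot = longestColumn A := by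
    rw [longestColumn_eq_column, topColumn, Finset.filter_true_of_mem fun x _ => hbot x]
  rw [hks, hrep]
  simp [hcol]

/-- The powers are told apart by length, since `A` is nonempty. -/
theorem longestColumn_pow_injective [Nonempty A] :
    Function.Injective fun k : ℕ => longestColumn A ^ k := by
  intro j k h
  have h := congrArg (fun g => Multiplicative.toAdd (length g)) h
  simp only [map_pow, longestColumn_eq_column, column, length_word, Finset.length_sort,
    toAdd_pow, toAdd_ofAdd, smul_eq_mul] at h
  exact Nat.eq_of_mul_eq_mul_right Fintype.card_pos h

end Finite

end PlacticMonoid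

/-! ### Free monoids on one generator, and the main theorem -/

theorem isFreeMonoidOn_singleton {M : Type*} [Monoid M] {c : M} {N : Submonoid M}
    (hinj : Function.Injective fun k : ℕ => c ^ k) (hN : Submonoid.closure {c} = N) :
    IsFreeMonoidOn N {c} := by
  refine ⟨fun u v huv => ?_, ?_⟩
  · have key (w : FreeMonoid ({c} : Set M)) :
        FreeMonoid.lift ((↑) : ({c} : Set M) → M) w = c ^ w.length := by
      rw [FreeMonoid.lift_apply, List.prod_eq_pow_card _ c fun x hx => ?_]
      · simp [FreeMonoid.length]
      · obtain ⟨y, -, rfl⟩ := List.mem_map.1 hx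
        exact y.2
    rw [key, key] at huv
    -- A word over a one-letter alphabet is determined by its length.
    refine FreeMonoid.toList.injective (List.ext_getElem (hinj huv) fun i _ _ => ?_)
    exact Subsingleton.elim _ _
  · rw [FreeMonoid.mrange_lift, Subtype.range_coe, hN]

open PlacticMonoid in
theorem mainTheorem9 {A : Type*} [LinearOrder A] :
    (∀ [Fintype A] [Nonempty A],
      IsFreeMonoidOn (Submonoid.center (PlacticMonoid A)) {longestColumn A}) ∧
    (∀ [Infinite A], Submonoid.center (PlacticMonoid A) = ⊥) := by
  refine ⟨isFreeMonoidOn_singleton longestColumn_pow_injective (le_antisymm ?_ fun g hg => ?_),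
    center_eq_bot⟩
  · exact (Submonoid.closure_singleton_le_iff_mem _ _).2 longestColumn_mem_center
  · exact Submonoid.mem_closure_singleton.2 (exists_longestColumn_pow_eq hg)
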